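/- For finite $A\subset\mathbb{R}$ write $A-A=\{a-b : a,b\in A\}$ and $A/A=\{a/b : a,b\in A,\ b\neq 0\}$, and let $\log$ be the logarithm to base $2$. (1) There are absolute constants $C,c>0$ such that for every finite set $A\subset\mathbb{R}$ with $|A|\ge 2$, $$|A|^{23}\le C\,(\log |A|)^{c}\,|A-A|^{6}\,|A/A|^{13}.$$ (2) In particular, there is an absolute constant $c>0$ such that for every $K>0$ there is a constant $C=C(K)>0$ with the following property: for every finite set $A\subset\mathbb{R}$ with $|A|\ge 2$ and $|A/A|\le K|A|$, $$|A|^{5/3}\le C\,(\log |A|)^{c}\,|A-A|.$$ -/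

import Mathlib

open scoped Pointwise

/-- The quotient set `{a / b : a ∈ A, b ∈ B, b ≠ 0}` of two finite sets of reals. -/
noncomputable def quotientSet (A B : Finset ℝ) : Finset ℝ :=
  Finset.image₂ (fun a b => a / b) A (B.filter (fun b => b ≠ 0))

/-! Write D = A - A, Q = A/A and suppose 0 ∉ A. For x ∈ Q let A_x = A ∩ xA, and let r_B(d) count the
representations of d as a difference in B. The sets A_x have total size |A|², so up to a logarithm
this mass sits on a set P ⊆ Q where |A_x| ≈ t, with t ≳ |A|²/|Q| and |P|t ≳ |A|²/log|A|.

Send (a, b, c) ∈ A_x × A_x × A to the pair (m, q) = ((a - b)/x, b - c) in D × D. Then mx + q = a - c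
is again in D, so the pairs reached, over all x ∈ P, are incidences between the grid P × D and |D|²
lines: Szemerédi–Trotter gives O(|P|^(2/3) |D|²) of them. Two triples collide exactly when a - a' =
b - b' = c - c', so collisions number ∑ r_{A_x}(d)² r_A(d), which Hölder bounds by third energies.

Few quotients force small third energy: if z = a - b, then every line y = (a/c)x - b with c ∈ A
meets the point (c, z), so a second use of Szemerédi–Trotter bounds the number of z with many
representations and yields |A| ∑ r_B³ ≲ log|A| |Q|²|B|² for B ⊆ A. Cauchy–Schwarz now gives |P| t⁸
|A|⁷ ≲ (log|A|)³ |Q|⁶ |D|⁶, and the lower bounds on t and |P|t finish. -/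

/-! ### Szemerédi–Trotter for grids, by cutting the grid into cells -/

/-- Incidences between the grid `X × Y` and the lines `y = m x + b`, `(m, b) ∈ L`, recorded as
pairs of an abscissa and a line. -/
noncomputable def gridIncidences (X Y : Finset ℝ) (L : Finset (ℝ × ℝ)) : Finset (ℝ × ℝ × ℝ) :=
  (X ×ˢ L).filter (fun p => p.2.1 * p.1 + p.2.2 ∈ Y)

/-- The index of the block containing `x` when `X` is cut into consecutive blocks of length `w`. -/
noncomputable def blockIndex (X : Finset ℝ) (w : ℕ) (x : ℝ) : ℕ :=
  (X.filter (fun y => y < x)).card / w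

lemma blockIndex_mono (X : Finset ℝ) (w : ℕ) : Monotone (blockIndex X w) := by
  intro x y hxy
  refine Nat.div_le_div_right (Finset.card_le_card fun z hz => ?_)
  rw [Finset.mem_filter] at hz ⊢
  exact ⟨hz.1, hz.2.trans_le hxy⟩

lemma blockIndex_le (X : Finset ℝ) (w : ℕ) (x : ℝ) : blockIndex X w x ≤ X.card / w :=
  Nat.div_le_div_right (Finset.card_filter_le _ _)

/-- The rank of a point (the number of elements of `X` below it) is injective on `X`, and the ranks
in one block lie in an interval of length `w`. -/
lemma card_block_le (X : Finset ℝ) {w : ℕ} (hw : 0 < w) (k : ℕ) :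
    (X.filter (fun x => blockIndex X w x = k)).card ≤ w := by
  have hinj : Set.InjOn (fun x => (X.filter (fun y => y < x)).card)
      (X.filter (fun x => blockIndex X w x = k)) := by
    have key : ∀ x ∈ X, ∀ y, x < y →
        (X.filter (fun z => z < x)).card < (X.filter (fun z => z < y)).card := by
      intro x hx y hxy
      refine Finset.card_lt_card ⟨fun z hz => ?_, fun h => ?_⟩
      · rw [Finset.mem_filter] at hz ⊢
        exact ⟨hz.1, hz.2.trans hxy⟩
      · have := h (Finset.mem_filter.2 ⟨hx, hxy⟩)
        simp at this
    intro x hx y hy hxy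
    simp only [Finset.coe_filter, Set.mem_ofPred_eq] at hx hy
    rcases lt_trichotomy x y with h | h | h
    · exact absurd hxy (key x hx.1 y h).ne
    · exact h
    · exact absurd hxy (key y hy.1 x h).ne'
  rw [← Finset.card_image_of_injOn hinj]
  calc _ ≤ (Finset.Ico (k * w) (k * w + w)).card := by
        refine Finset.card_le_card fun n hn => ?_
        obtain ⟨x, hx, rfl⟩ := Finset.mem_image.1 hn
        have h := (Finset.mem_filter.1 hx).2
        unfold blockIndex at h
        rw [Nat.div_eq_iff hw] at h
        rw [Finset.mem_Ico]
        omega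
    _ = w := by simp

/-- Fibrewise this is n ≤ 1 + n(n - 1) for n ≥ 1. With `f` the cell of a point on a line, it splits
incidences into cells met and pairs sharing a cell. -/
lemma card_le_card_image_add_collisions {α β : Type*} [DecidableEq α] [DecidableEq β]
    (s : Finset α) (f : α → β) :
    s.card ≤ (s.image f).card + (s.offDiag.filter (fun p => f p.1 = f p.2)).card := by
  have h1 : s.card = ∑ c ∈ s.image f, (s.filter (fun x => f x = c)).card :=
    Finset.card_eq_sum_card_fiberwise fun x hx => Finset.mem_image_of_mem f hx
  have h2 : (s.offDiag.filter (fun p => f p.1 = f p.2)).card =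
      ∑ c ∈ s.image f, ((s.filter (fun x => f x = c)).offDiag).card := by
    rw [Finset.card_eq_sum_card_fiberwise (f := fun p : α × α => f p.1) (t := s.image f)]
    · refine Finset.sum_congr rfl fun c _ => congrArg Finset.card ?_
      ext ⟨x, y⟩
      simp only [Finset.mem_filter, Finset.mem_offDiag]
      grind
    · intro p hp
      simp only [Finset.coe_filter, Set.mem_ofPred_eq, Finset.mem_offDiag] at hp
      exact Finset.mem_image_of_mem f hp.1.1
  rw [h1, h2, Finset.card_eq_sum_ones, ← Finset.sum_add_distrib]
  refine Finset.sum_le_sum fun c _ => ?_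
  rw [Finset.offDiag_card]
  generalize (s.filter (fun x => f x = c)).card = n
  rcases n with _ | n
  · simp
  · have : (n + 1) * (n + 1) = n * n + n + (n + 1) := by ring
    rw [this, Nat.add_sub_cancel]
    nlinarith

/-- A line of non-zero slope meets few cells. -/
lemma card_cells_le (X Y s : Finset ℝ) (w h : ℕ) {m : ℝ} (hm : m ≠ 0) (b : ℝ) :
    (s.image (fun x => (blockIndex X w x, blockIndex Y h (m * x + b)))).card ≤
      X.card / w + Y.card / h + 1 := by
  have hX := blockIndex_le X w
  have hY := blockIndex_le Y h
  generalize X.card / w = r at *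
  generalize Y.card / h = q at *
  rcases lt_or_gt_of_ne hm with hm | hm
  · calc _ ≤ (Finset.range (r + q + 1)).card := by
          -- Along a line the cells form a monotone chain once the row index is reversed for
          -- negative slope. On a chain the sum of the coordinates is injective, and it is at most
          -- `r + q`.
          refine Finset.card_le_card_of_injOn (fun c => c.1 + (q - c.2)) ?_ ?_
          · intro c hc
            obtain ⟨x, -, rfl⟩ := Finset.mem_image.1 hc
            have := hX x
            simp only [Finset.coe_range, Set.mem_Iio]
            omega
          · intro c hc d hd hcd
            obtain ⟨x, -, rfl⟩ := Finset.mem_image.1 hc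
            obtain ⟨y, -, rfl⟩ := Finset.mem_image.1 hd
            have h1 := hY (m * x + b)
            have h2 := hY (m * y + b)
            simp only at hcd
            rcases le_total x y with hxy | hxy
            · have h3 := blockIndex_mono X w hxy
              have h4 : blockIndex Y h (m * y + b) ≤ blockIndex Y h (m * x + b) :=
                blockIndex_mono Y h (by nlinarith)
              ext <;> simp only <;> omega
            · have h3 := blockIndex_mono X w hxy
              have h4 : blockIndex Y h (m * x + b) ≤ blockIndex Y h (m * y + b) :=
                blockIndex_mono Y h (by nlinarith)
              ext <;> simp only <;> omega
      _ = _ := by simp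
  · calc _ ≤ (Finset.range (r + q + 1)).card := by
          refine Finset.card_le_card_of_injOn (fun c => c.1 + c.2) ?_ ?_
          · intro c hc
            obtain ⟨x, -, rfl⟩ := Finset.mem_image.1 hc
            have := hX x
            have := hY (m * x + b)
            simp only [Finset.coe_range, Set.mem_Iio]
            omega
          · intro c hc d hd hcd
            obtain ⟨x, -, rfl⟩ := Finset.mem_image.1 hc
            obtain ⟨y, -, rfl⟩ := Finset.mem_image.1 hd
            simp only at hcd
            rcases le_total x y with hxy | hxy
            · have h3 := blockIndex_mono X w hxy
              have h4 : blockIndex Y h (m * x + b) ≤ blockIndex Y h (m * y + b) :=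
                blockIndex_mono Y h (by nlinarith)
              ext <;> simp only <;> omega
            · have h3 := blockIndex_mono X w hxy
              have h4 : blockIndex Y h (m * y + b) ≤ blockIndex Y h (m * x + b) :=
                blockIndex_mono Y h (by nlinarith)
              ext <;> simp only <;> omega
      _ = _ := by simp

/-- Pairs of grid points lying in a common cell. -/
lemma card_pairs_same_cell_le (X Y : Finset ℝ) {w h : ℕ} (hw : 0 < w) (hh : 0 < h) :
    (((X ×ˢ Y) ×ˢ (X ×ˢ Y)).filter (fun p => blockIndex X w p.1.1 = blockIndex X w p.2.1 ∧
      blockIndex Y h p.1.2 = blockIndex Y h p.2.2)).card ≤ X.card * Y.card * (w * h) := by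
  rw [Finset.card_filter, Finset.sum_product]
  calc _ ≤ ∑ p ∈ X ×ˢ Y, w * h := by
        refine Finset.sum_le_sum fun p _ => ?_
        rw [← Finset.card_filter]
        calc _ ≤ ((X.filter (fun x => blockIndex X w x = blockIndex X w p.1)) ×ˢ
              (Y.filter (fun y => blockIndex Y h y = blockIndex Y h p.2))).card := by
              refine Finset.card_le_card fun q hq => ?_
              simp only [Finset.mem_filter, Finset.mem_product] at hq ⊢
              exact ⟨⟨hq.1.1, hq.2.1.symm⟩, hq.1.2, hq.2.2.symm⟩
          _ ≤ w * h := by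
              rw [Finset.card_product]
              exact Nat.mul_le_mul (card_block_le X hw _) (card_block_le Y hh _)
    _ = _ := by simp [Finset.card_product]

lemma card_gridIncidences_eq_sum (X Y : Finset ℝ) (L : Finset (ℝ × ℝ)) :
    (gridIncidences X Y L).card =
      ∑ l ∈ L, (X.filter (fun x => l.1 * x + l.2 ∈ Y)).card := by
  unfold gridIncidences
  rw [Finset.card_filter, Finset.sum_product_right]
  exact Finset.sum_congr rfl fun l _ => (Finset.card_filter _ _).symm

/-- Two distinct points on a non-vertical line determine it, so the collisions of all lines together
embed into the pairs of grid points sharing a cell. -/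
lemma card_gridIncidences_le_cells (X Y : Finset ℝ) (L : Finset (ℝ × ℝ))
    (hL : ∀ l ∈ L, l.1 ≠ 0) {w h : ℕ} (hw : 0 < w) (hh : 0 < h) :
    (gridIncidences X Y L).card ≤
      L.card * (X.card / w + Y.card / h + 1) + X.card * Y.card * (w * h) := by
  classical
  set S : ℝ × ℝ → Finset ℝ := fun l => X.filter (fun x => l.1 * x + l.2 ∈ Y)
  set κ : ℝ × ℝ → ℝ → ℕ × ℕ := fun l x => (blockIndex X w x, blockIndex Y h (l.1 * x + l.2))
  have hpairs : ∑ l ∈ L, ((S l).offDiag.filter (fun p => κ l p.1 = κ l p.2)).card ≤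
      X.card * Y.card * (w * h) := by
    refine le_trans ?_ (card_pairs_same_cell_le X Y hw hh)
    rw [← Finset.card_sigma]
    refine Finset.card_le_card_of_injOn
      (fun q => ((q.2.1, q.1.1 * q.2.1 + q.1.2), (q.2.2, q.1.1 * q.2.2 + q.1.2))) ?_ ?_
    · rintro ⟨l, x, y⟩ hq
      simp only [Finset.coe_sigma, Finset.coe_filter, Finset.mem_offDiag, Set.mem_sigma_iff,
        Set.mem_ofPred_eq, S, Finset.mem_filter, κ, Prod.mk.injEq, Finset.mem_coe] at hq
      simp only [Finset.coe_filter, Set.mem_ofPred_eq, Finset.mem_product]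
      tauto
    · rintro ⟨⟨m, b⟩, x, y⟩ hq ⟨⟨m', b'⟩, x', y'⟩ hq' heq
      simp only [Finset.coe_sigma, Finset.coe_filter, Finset.mem_offDiag, Set.mem_sigma_iff,
        Set.mem_ofPred_eq] at hq
      simp only [Prod.mk.injEq] at heq
      obtain ⟨⟨rfl, h1⟩, rfl, h2⟩ := heq
      have hne : x - y ≠ 0 := sub_ne_zero.2 hq.2.1.2.2
      have hm : m = m' := by
        apply mul_right_cancel₀ hne
        linarith
      subst hm
      have hb : b = b' := by linarith
      subst hb
      rfl
  rw [card_gridIncidences_eq_sum]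
  calc ∑ l ∈ L, (S l).card
      ≤ ∑ l ∈ L, ((X.card / w + Y.card / h + 1) +
          ((S l).offDiag.filter (fun p => κ l p.1 = κ l p.2)).card) := by
        refine Finset.sum_le_sum fun l hl => ?_
        refine (card_le_card_image_add_collisions (S l) (κ l)).trans ?_
        exact Nat.add_le_add_right (card_cells_le X Y (S l) w h (hL l hl) l.2) _
    _ ≤ _ := by
        rw [Finset.sum_add_distrib, Finset.sum_const, smul_eq_mul]
        exact Nat.add_le_add_left hpairs _

lemma card_gridIncidences_le_mul_card_left (X Y : Finset ℝ) (L : Finset (ℝ × ℝ)) :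
    (gridIncidences X Y L).card ≤ L.card * X.card := by
  rw [card_gridIncidences_eq_sum, ← smul_eq_mul, ← Finset.sum_const]
  exact Finset.sum_le_sum fun l _ => Finset.card_filter_le _ _

lemma card_gridIncidences_le_mul_card_right (X Y : Finset ℝ) (L : Finset (ℝ × ℝ))
    (hL : ∀ l ∈ L, l.1 ≠ 0) :
    (gridIncidences X Y L).card ≤ L.card * Y.card := by
  rw [card_gridIncidences_eq_sum, ← smul_eq_mul, ← Finset.sum_const]
  refine Finset.sum_le_sum fun l hl => ?_
  refine Finset.card_le_card_of_injOn (fun x => l.1 * x + l.2) ?_ ?_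
  · intro x hx
    simp only [Finset.coe_filter, Set.mem_ofPred_eq] at hx
    exact hx.2
  · intro x _ y _ hxy
    exact mul_left_cancel₀ (hL l hl) (add_right_cancel hxy)

/-- **Szemerédi–Trotter for Cartesian products**, lines of non-zero slope. -/
theorem card_gridIncidences_cube_le (X Y : Finset ℝ) (L : Finset (ℝ × ℝ))
    (hL : ∀ l ∈ L, l.1 ≠ 0) :
    ((gridIncidences X Y L).card : ℝ) ^ 3 ≤
      343 * (((X.card : ℝ) * Y.card * L.card) ^ 2 + (L.card : ℝ) ^ 3) := by
  rcases L.eq_empty_or_nonempty with rfl | hLne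
  · simp [gridIncidences]
  have hl : (0 : ℝ) < L.card := by exact_mod_cast hLne.card_pos
  have hI0 : (0 : ℝ) ≤ (gridIncidences X Y L).card := by positivity
  have hIx : ((gridIncidences X Y L).card : ℝ) ≤ L.card * X.card := by
    exact_mod_cast card_gridIncidences_le_mul_card_left X Y L
  have hIy : ((gridIncidences X Y L).card : ℝ) ≤ L.card * Y.card := by
    exact_mod_cast card_gridIncidences_le_mul_card_right X Y L hL
  rcases X.eq_empty_or_nonempty with rfl | hXne
  · have : ((gridIncidences ∅ Y L).card : ℝ) = 0 := by simp [gridIncidences]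
    rw [this, zero_pow three_ne_zero]; positivity
  rcases Y.eq_empty_or_nonempty with rfl | hYne
  · have : ((gridIncidences X ∅ L).card : ℝ) = 0 := by simp [gridIncidences]
    rw [this, zero_pow three_ne_zero]; positivity
  have hx : (0 : ℝ) < X.card := by exact_mod_cast hXne.card_pos
  have hy : (0 : ℝ) < Y.card := by exact_mod_cast hYne.card_pos
  have hcell : ∀ w h : ℕ, 0 < w → 0 < h → ((gridIncidences X Y L).card : ℝ) ≤
      L.card * ((X.card : ℝ) / w + Y.card / h + 1) + X.card * Y.card * (w * h) := by
    intro w h hw hh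
    have h0 := card_gridIncidences_le_cells X Y L hL hw hh
    have h1 : ((gridIncidences X Y L).card : ℝ) ≤
      L.card * (((X.card / w : ℕ) : ℝ) + (Y.card / h : ℕ) + 1) + X.card * Y.card * (w * h) := by
      exact_mod_cast h0
    refine h1.trans ?_
    gcongr
    · exact Nat.cast_div_le
    · exact Nat.cast_div_le
  generalize ((gridIncidences X Y L).card : ℝ) = I at *
  have hXc := hXne.card_pos
  have hYc := hYne.card_pos
  generalize hX' : X.card = nx at *
  generalize hY' : Y.card = ny at *
  generalize (L.card : ℝ) = l at *
  -- With so many lines, a single block in each direction suffices and the line term dominates.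
  by_cases hsmall : ((nx : ℝ) * ny) ^ 2 ≤ l
  · have h1 := hcell nx ny hXc hYc
    rw [div_self hx.ne', div_self hy.ne'] at h1
    have h2 : I ≤ 4 * l := by nlinarith
    calc I ^ 3 ≤ (4 * l) ^ 3 := by gcongr
      _ ≤ _ := by nlinarith [pow_pos hl 3, sq_nonneg ((nx : ℝ) * ny * l)]
  push Not at hsmall
  -- This `r` balances the two terms of the cell bound: with about `r` blocks on each axis, both are
  -- of order `l * r`. The trivial bounds cover the case where `r` exceeds `nx` or `ny`.
  obtain ⟨r, hr0, hr⟩ : ∃ r : ℝ, 0 < r ∧ r ^ 3 = ((nx : ℝ) * ny) ^ 2 / l := by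
    refine ⟨(((nx : ℝ) * ny) ^ 2 / l) ^ ((1 : ℝ) / 3), by positivity, ?_⟩
    rw [← Real.rpow_natCast, ← Real.rpow_mul (by positivity)]
    norm_num
  have hrl : l * r ^ 3 = ((nx : ℝ) * ny) ^ 2 := by rw [hr]; field_simp
  have hr1 : 1 ≤ r := by
    by_contra hlt
    push Not at hlt
    have : r ^ 3 < 1 := pow_lt_one₀ hr0.le hlt (by norm_num)
    nlinarith
  have hmain : I ≤ 7 * (l * r) := by
    by_cases hrx : (nx : ℝ) < r
    · have : l * nx ≤ l * r := by gcongr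
      nlinarith [mul_pos hl hr0]
    by_cases hry : (ny : ℝ) < r
    · have : l * ny ≤ l * r := by gcongr
      nlinarith [mul_pos hl hr0]
    push Not at hrx hry
    have hcx : (0 : ℝ) < nx / r := by positivity
    have hcy : (0 : ℝ) < ny / r := by positivity
    have h1 := hcell ⌈(nx : ℝ) / r⌉₊ ⌈(ny : ℝ) / r⌉₊ (Nat.ceil_pos.2 hcx) (Nat.ceil_pos.2 hcy)
    -- Rounding up costs at most a factor 2 because `r ≤ nx`.
    have hw : (⌈(nx : ℝ) / r⌉₊ : ℝ) ≤ 2 * (nx / r) :=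
      (Nat.ceil_lt_add_one hcx.le).le.trans (by linarith [(one_le_div hr0).2 hrx])
    have hh : (⌈(ny : ℝ) / r⌉₊ : ℝ) ≤ 2 * (ny / r) :=
      (Nat.ceil_lt_add_one hcy.le).le.trans (by linarith [(one_le_div hr0).2 hry])
    have hw' : (nx : ℝ) / ⌈(nx : ℝ) / r⌉₊ ≤ r := by
      rw [div_le_iff₀ (by exact_mod_cast Nat.ceil_pos.2 hcx), mul_comm, ← div_le_iff₀ hr0]
      exact Nat.le_ceil _
    have hh' : (ny : ℝ) / ⌈(ny : ℝ) / r⌉₊ ≤ r := by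
      rw [div_le_iff₀ (by exact_mod_cast Nat.ceil_pos.2 hcy), mul_comm, ← div_le_iff₀ hr0]
      exact Nat.le_ceil _
    calc I ≤ _ := h1
      _ ≤ l * (r + r + r) + nx * ny * (2 * (nx / r) * (2 * (ny / r))) := by gcongr
      _ = 3 * (l * r) + 4 * ((nx * ny) ^ 2 / r ^ 2) := by field_simp; ring
      _ = 3 * (l * r) + 4 * (l * r) := by rw [← hrl]; field_simp
      _ = 7 * (l * r) := by ring
  calc I ^ 3 ≤ (7 * (l * r)) ^ 3 := by gcongr
    _ = 343 * (l ^ 2 * (l * r ^ 3)) := by ring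
    _ = 343 * ((nx * ny * l) ^ 2) := by rw [hrl]; ring
    _ ≤ _ := by nlinarith [pow_pos hl 3]

/-! ### Difference representations and third energy -/

/-- The number of representations of `d` as a difference of two elements of `B`. -/
noncomputable def diffRep (B : Finset ℝ) (d : ℝ) : ℕ :=
  ((B ×ˢ B).filter (fun p => p.1 - p.2 = d)).card

lemma diffRep_le_card (B : Finset ℝ) (d : ℝ) : diffRep B d ≤ B.card := by
  refine Finset.card_le_card_of_injOn Prod.fst ?_ ?_
  · intro p hp
    simp only [Finset.coe_filter, Set.mem_ofPred_eq, Finset.mem_product] at hp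
    exact hp.1.1
  · intro p hp q hq hpq
    simp only [Finset.coe_filter, Set.mem_ofPred_eq, Finset.mem_product] at hp hq
    ext
    · exact hpq
    · linarith [hp.2, hq.2]

lemma ne_zero_of_mem_quotientSet {A : Finset ℝ} (hA : (0 : ℝ) ∉ A) {x : ℝ}
    (hx : x ∈ quotientSet A A) : x ≠ 0 := by
  obtain ⟨a, ha, b, hb, rfl⟩ := Finset.mem_image₂.1 hx
  exact div_ne_zero (fun h => hA (h ▸ ha)) (Finset.mem_filter.1 hb).2

lemma div_mem_quotientSet {A : Finset ℝ} (hA : (0 : ℝ) ∉ A) {a b : ℝ}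
    (ha : a ∈ A) (hb : b ∈ A) : a / b ∈ quotientSet A A :=
  Finset.mem_image₂.2 ⟨a, ha, b, Finset.mem_filter.2 ⟨hb, fun h => hA (h ▸ hb)⟩, rfl⟩

lemma card_le_card_quotientSet {A : Finset ℝ} (hA : (0 : ℝ) ∉ A) :
    A.card ≤ (quotientSet A A).card := by
  rcases A.eq_empty_or_nonempty with rfl | ⟨b, hb⟩
  · simp
  · refine Finset.card_le_card_of_injOn (fun a => a / b)
      (fun a ha => div_mem_quotientSet hA ha hb) ?_
    intro x _ y _ hxy
    have hb0 : b ≠ 0 := fun h => hA (h ▸ hb)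
    exact (div_left_inj' hb0).1 hxy

/-- A representation z = a - b and an element c of `A` give an incidence of the line y = (a/c)x - b
with the point (c, z), and the incidence recovers (z, a, b, c). -/
lemma mul_card_le_card_gridIncidences {A B S : Finset ℝ} (hA : (0 : ℝ) ∉ A) (hB : B ⊆ A) {t : ℕ}
    (hS : ∀ z ∈ S, t ≤ diffRep B z) :
    t * S.card * A.card ≤
      (gridIncidences A S (quotientSet A A ×ˢ B.image (fun b => -b))).card := by
  calc t * S.card * A.card ≤ (∑ z ∈ S, diffRep B z) * A.card := by
        refine Nat.mul_le_mul_right _ ?_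
        rw [mul_comm, ← smul_eq_mul, ← Finset.sum_const]
        exact Finset.sum_le_sum hS
    _ = ((S.sigma (fun z => (B ×ˢ B).filter (fun p => p.1 - p.2 = z))) ×ˢ A).card := by
        rw [Finset.card_product, Finset.card_sigma]; rfl
    _ ≤ _ := by
        refine Finset.card_le_card_of_injOn (fun q => (q.2, q.1.2.1 / q.2, -q.1.2.2)) ?_ ?_
        · rintro ⟨⟨z, a, b⟩, c⟩ hq
          simp only [Finset.coe_product, Finset.coe_sigma, Set.mem_prod, Set.mem_sigma_iff,
            Finset.coe_filter, Set.mem_ofPred_eq, Finset.mem_product, Finset.mem_coe] at hq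
          obtain ⟨⟨hz, ⟨ha, hb⟩, rfl⟩, hc⟩ := hq
          have hc0 : c ≠ 0 := fun h => hA (h ▸ hc)
          simp only [gridIncidences, Finset.coe_filter, Set.mem_ofPred_eq, Finset.mem_product]
          refine ⟨⟨hc, div_mem_quotientSet hA (hB ha) hc, Finset.mem_image_of_mem _ hb⟩, ?_⟩
          rwa [div_mul_cancel₀ _ hc0, ← sub_eq_add_neg]
        · rintro ⟨⟨z, a, b⟩, c⟩ hq ⟨⟨z', a', b'⟩, c'⟩ hq' heq
          simp only [Finset.coe_product, Finset.coe_sigma, Set.mem_prod, Set.mem_sigma_iff,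
            Finset.coe_filter, Set.mem_ofPred_eq, Finset.mem_product, Finset.mem_coe] at hq hq'
          obtain ⟨⟨hz, ⟨ha, hb⟩, rfl⟩, hc⟩ := hq
          obtain ⟨⟨hz', ⟨ha', hb'⟩, rfl⟩, hc'⟩ := hq'
          simp only [Prod.mk.injEq, neg_inj] at heq
          obtain ⟨rfl, h1, rfl⟩ := heq
          have hc0 : c ≠ 0 := fun h => hA (h ▸ hc)
          obtain rfl := (div_left_inj' hc0).1 h1
          rfl

/-- Level sets of the difference representation function of a subset of a set with few
quotients. -/
lemma card_level_diffRep_le {A B S : Finset ℝ} (hA : (0 : ℝ) ∉ A) (hB : B ⊆ A) {t : ℕ}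
    (ht : 0 < t) (hS : ∀ z ∈ S, t ≤ diffRep B z) :
    (t : ℝ) ^ 3 * S.card * A.card ≤ 686 * ((quotientSet A A).card : ℝ) ^ 2 * (B.card : ℝ) ^ 2 := by
  rcases S.eq_empty_or_nonempty with rfl | ⟨z, hz⟩
  · simp; positivity
  have htB : t ≤ B.card := (hS z hz).trans (diffRep_le_card B z)
  have hBA : B.card ≤ A.card := Finset.card_le_card hB
  have hAQ := card_le_card_quotientSet hA
  have hS0 : 0 < S.card := Finset.card_pos.2 ⟨z, hz⟩
  have hinc : (t : ℝ) * S.card * A.card ≤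
      (gridIncidences A S (quotientSet A A ×ˢ B.image (fun b => -b))).card := by
    exact_mod_cast mul_card_le_card_gridIncidences hA hB hS
  have hST := card_gridIncidences_cube_le A S (quotientSet A A ×ˢ B.image (fun b => -b))
    (fun l hl => ne_zero_of_mem_quotientSet hA (Finset.mem_product.1 hl).1)
  rw [Finset.card_product, Finset.card_image_of_injective _ neg_injective] at hST
  have h3 := (pow_le_pow_left₀ (by positivity) hinc 3).trans hST
  push_cast at h3
  have ha : (0 : ℝ) < A.card := by exact_mod_cast (ht.trans_le htB).trans_le hBA
  have hb : (0 : ℝ) < B.card := by exact_mod_cast (ht.trans_le htB)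
  have ht' : (0 : ℝ) < t := by exact_mod_cast ht
  have hs : (0 : ℝ) < S.card := by exact_mod_cast hS0
  have h1 : (t : ℝ) ≤ B.card := by exact_mod_cast htB
  have h2 : (B.card : ℝ) ≤ (quotientSet A A).card := by exact_mod_cast hBA.trans hAQ
  generalize (A.card : ℝ) = a at *
  generalize (B.card : ℝ) = b at *
  generalize (t : ℝ) = τ at *
  generalize (S.card : ℝ) = s at *
  generalize ((quotientSet A A).card : ℝ) = q at *
  have hq : 0 < q := hb.trans_le h2
  by_cases hc : (q * b) ^ 3 ≤ (a * s * (q * b)) ^ 2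
  · have h4 : (τ * s * a) ^ 3 ≤ 686 * (a * s * (q * b)) ^ 2 := by linarith
    have h5 : (τ ^ 3 * s * a) * (s * a) ^ 2 ≤ (686 * q ^ 2 * b ^ 2) * (s * a) ^ 2 := by
      nlinarith
    exact le_of_mul_le_mul_right h5 (by positivity)
  -- Here the line term of Szemerédi–Trotter dominates, and 686 ≤ 9³. The missing factor `τ ^ 2` is
  -- paid for by τ ≤ |B| ≤ |Q|.
  · push Not at hc
    have h4 : (τ * s * a) ^ 3 ≤ (9 * (q * b)) ^ 3 := by nlinarith [pow_pos (mul_pos hq hb) 3]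
    have h5 : τ * s * a ≤ 9 * (q * b) := le_of_pow_le_pow_left₀ (by norm_num) (by positivity) h4
    have h6 : τ ^ 2 ≤ q * b := by nlinarith
    calc τ ^ 3 * s * a = τ ^ 2 * (τ * s * a) := by ring
      _ ≤ (q * b) * (9 * (q * b)) := by gcongr
      _ ≤ _ := by nlinarith [mul_pos (mul_pos hq hb) (mul_pos hq hb)]

/-- Third additive energy of a subset of a set with few quotients. -/
lemma sum_diffRep_cube_le {A B : Finset ℝ} (hA : (0 : ℝ) ∉ A) (hB : B ⊆ A) (D : Finset ℝ) :
    (∑ d ∈ D, (diffRep B d : ℝ) ^ 3) * A.card ≤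
      5488 * (Nat.log 2 A.card + 1 : ℕ) * ((quotientSet A A).card : ℝ) ^ 2 * (B.card : ℝ) ^ 2 := by
  -- Since `Nat.log 2 0 = 0`, differences with no representation would otherwise fall in the level j
  -- = 0 and break the lower bound 2^j.
  set D' := D.filter (fun d => diffRep B d ≠ 0)
  have hD' : ∑ d ∈ D, (diffRep B d : ℝ) ^ 3 = ∑ d ∈ D', (diffRep B d : ℝ) ^ 3 := by
    refine (Finset.sum_subset (Finset.filter_subset _ _) fun d hd hnd => ?_).symm
    have : diffRep B d = 0 := by
      by_contra h
      exact hnd (Finset.mem_filter.2 ⟨hd, h⟩)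
    simp [this]
  have hmap : ∀ d ∈ D', Nat.log 2 (diffRep B d) ∈ Finset.range (Nat.log 2 A.card + 1) := by
    intro d _
    rw [Finset.mem_range]
    exact Nat.lt_succ_of_le
      (Nat.log_mono_right ((diffRep_le_card B d).trans (Finset.card_le_card hB)))
  rw [hD', ← Finset.sum_fiberwise_of_maps_to hmap, Finset.sum_mul]
  -- Each dyadic level contributes 8 · 686 = 5488, the 8 coming from r < 2^(j+1).
  calc _ ≤ ∑ j ∈ Finset.range (Nat.log 2 A.card + 1),
        5488 * (((quotientSet A A).card : ℝ) ^ 2 * (B.card : ℝ) ^ 2) := by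
        refine Finset.sum_le_sum fun j _ => ?_
        set S := D'.filter (fun d => Nat.log 2 (diffRep B d) = j)
        have hS : ∀ z ∈ S, 2 ^ j ≤ diffRep B z := by
          intro z hz
          have hz' := Finset.mem_filter.1 hz
          rw [← hz'.2]
          exact Nat.pow_log_le_self 2 (Finset.mem_filter.1 hz'.1).2
        have hlev := card_level_diffRep_le hA hB (Nat.two_pow_pos j) hS
        have hsum : ∑ d ∈ S, (diffRep B d : ℝ) ^ 3 ≤ ∑ d ∈ S, (8 * ((2 ^ j : ℕ) : ℝ) ^ 3) := by
          refine Finset.sum_le_sum fun d hd => ?_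
          have hlt : diffRep B d < 2 ^ (j + 1) := by
            rw [← (Finset.mem_filter.1 hd).2]
            exact Nat.lt_pow_succ_log_self (by norm_num) _
          have hle : (diffRep B d : ℝ) ≤ 2 * ((2 ^ j : ℕ) : ℝ) := by
            have : diffRep B d ≤ 2 * 2 ^ j := by rw [pow_succ] at hlt; omega
            exact_mod_cast this
          calc _ ≤ (2 * ((2 ^ j : ℕ) : ℝ)) ^ 3 := by gcongr
            _ = _ := by ring
        rw [Finset.sum_const, nsmul_eq_mul] at hsum
        calc _ ≤ (S.card * (8 * ((2 ^ j : ℕ) : ℝ) ^ 3)) * A.card := by gcongr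
          _ = 8 * (((2 ^ j : ℕ) : ℝ) ^ 3 * S.card * A.card) := by ring
          _ ≤ 8 * (686 * ((quotientSet A A).card : ℝ) ^ 2 * (B.card : ℝ) ^ 2) := by gcongr
          _ = _ := by ring
    _ = _ := by
        rw [Finset.sum_const, Finset.card_range, nsmul_eq_mul]; ring

/-- Hölder with exponents 3/2 and 3, cubed to avoid fractional powers. It separates the mixed energy
∑ r_{A_x}² r_A into third energies. -/
lemma sum_sq_mul_cube_le {ι : Type*} (s : Finset ι) (f g : ι → ℝ) (hf : ∀ i, 0 ≤ f i)
    (hg : ∀ i, 0 ≤ g i) :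
    (∑ i ∈ s, f i ^ 2 * g i) ^ 3 ≤ (∑ i ∈ s, f i ^ 3) ^ 2 * ∑ i ∈ s, g i ^ 3 := by
  have hpq : Real.HolderConjugate (3 / 2) 3 := by
    rw [Real.holderConjugate_iff]; norm_num
  have h := Real.inner_le_Lp_mul_Lq_of_nonneg s hpq (f := fun i => f i ^ 2) (g := g)
    (fun i _ => by positivity) (fun i _ => hg i)
  have e1 : ∀ i, (f i ^ 2) ^ (3 / 2 : ℝ) = f i ^ 3 := by
    intro i
    rw [← Real.rpow_natCast, ← Real.rpow_mul (hf i), ← Real.rpow_natCast]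
    norm_num
  have e2 : ∀ i, g i ^ (3 : ℝ) = g i ^ 3 := fun i => by
    rw [← Real.rpow_natCast]; norm_num
  simp only [e1, e2] at h
  have hF : 0 ≤ ∑ i ∈ s, f i ^ 3 := Finset.sum_nonneg fun i _ => pow_nonneg (hf i) 3
  have hG : 0 ≤ ∑ i ∈ s, g i ^ 3 := Finset.sum_nonneg fun i _ => pow_nonneg (hg i) 3
  have h0 : 0 ≤ ∑ i ∈ s, f i ^ 2 * g i :=
    Finset.sum_nonneg fun i _ => mul_nonneg (by positivity) (hg i)
  refine (pow_le_pow_left₀ h0 h 3).trans (le_of_eq ?_)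
  rw [mul_pow, ← Real.rpow_natCast, ← Real.rpow_natCast (_ ^ (1 / 3 : ℝ)), ← Real.rpow_mul hF,
    ← Real.rpow_mul hG, ← Real.rpow_natCast (∑ i ∈ s, f i ^ 3)]
  norm_num

/-! ### Intersections of A with its dilates -/

/-- The pairs `(m, q) ∈ D × D` with `m x + q ∈ D`, where `D = A - A`. -/
noncomputable def dilatePairs (A : Finset ℝ) (x : ℝ) : Finset (ℝ × ℝ) :=
  ((A - A) ×ˢ (A - A)).filter (fun l => l.1 * x + l.2 ∈ A - A)

/-- The part of `A` lying in its dilate by `x`. -/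
noncomputable def dilatePart (A : Finset ℝ) (x : ℝ) : Finset ℝ :=
  A.filter (fun a => a / x ∈ A)

/-- Cauchy–Schwarz for the map (a, b, c) ↦ ((a - b)/x, b - c), which takes values in `dilatePairs A
x`. Triples with equal image have a common difference d = a - a' = b - b' = c - c', which gives the
energy on the right. -/
lemma card_dilatePart_sq_mul_card_sq_le (A : Finset ℝ) {x : ℝ} (hx : x ≠ 0) :
    (((dilatePart A x).card : ℝ) ^ 2 * A.card) ^ 2 ≤ (dilatePairs A x).card *
      ∑ d ∈ A - A, (diffRep (dilatePart A x) d : ℝ) ^ 2 * diffRep A d := by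
  classical
  set B := dilatePart A x
  set T := B ×ˢ B ×ˢ A
  set φ : ℝ × ℝ × ℝ → ℝ × ℝ := fun t => ((t.1 - t.2.1) / x, t.2.1 - t.2.2)
  have hBA : ∀ a ∈ B, a ∈ A ∧ a / x ∈ A := fun a ha => Finset.mem_filter.1 ha
  have hmaps : ∀ t ∈ T, φ t ∈ dilatePairs A x := by
    rintro ⟨a, b, c⟩ ht
    simp only [T, Finset.mem_product] at ht
    obtain ⟨ha, hb, hc⟩ := ht
    simp only [φ, dilatePairs, Finset.mem_filter, Finset.mem_product]
    refine ⟨⟨?_, Finset.sub_mem_sub (hBA b hb).1 hc⟩, ?_⟩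
    · rw [sub_div]
      exact Finset.sub_mem_sub (hBA a ha).2 (hBA b hb).2
    · rw [div_mul_cancel₀ _ hx, sub_add_sub_cancel]
      exact Finset.sub_mem_sub (hBA a ha).1 hc
  have hcardT : T.card = B.card ^ 2 * A.card := by
    simp only [T, Finset.card_product]; ring
  have hfib : T.card = ∑ l ∈ dilatePairs A x, (T.filter (fun t => φ t = l)).card :=
    Finset.card_eq_sum_card_fiberwise hmaps
  have hsecond : ∑ l ∈ dilatePairs A x, (T.filter (fun t => φ t = l)).card ^ 2 ≤
      ∑ d ∈ A - A, diffRep B d ^ 2 * diffRep A d := by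
    have e1 : ∑ l ∈ dilatePairs A x, (T.filter (fun t => φ t = l)).card ^ 2 =
        ((dilatePairs A x).sigma (fun l => (T.filter (fun t => φ t = l)) ×ˢ
          (T.filter (fun t => φ t = l)))).card := by
      rw [Finset.card_sigma]
      exact Finset.sum_congr rfl fun l _ => by rw [Finset.card_product, sq]
    have e2 : ∑ d ∈ A - A, diffRep B d ^ 2 * diffRep A d =
        ((A - A).sigma (fun d => ((B ×ˢ B).filter (fun p => p.1 - p.2 = d)) ×ˢ
          ((B ×ˢ B).filter (fun p => p.1 - p.2 = d)) ×ˢ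
          ((A ×ˢ A).filter (fun p => p.1 - p.2 = d)))).card := by
      rw [Finset.card_sigma]
      refine Finset.sum_congr rfl fun d _ => ?_
      rw [Finset.card_product, Finset.card_product]
      unfold diffRep
      ring
    rw [e1, e2]
    refine Finset.card_le_card_of_injOn (fun q => ⟨q.2.1.1 - q.2.2.1,
      ((q.2.1.1, q.2.2.1), (q.2.1.2.1, q.2.2.2.1), (q.2.1.2.2, q.2.2.2.2))⟩) ?_ ?_
    · rintro ⟨l, ⟨a, b, c⟩, ⟨a', b', c'⟩⟩ hq
      simp only [Finset.mem_coe, Finset.mem_sigma, Finset.mem_product, Finset.mem_filter, T,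
        φ] at hq
      obtain ⟨-, ⟨⟨ha, hb, hc⟩, h1⟩, ⟨ha', hb', hc'⟩, h2⟩ := hq
      have h := h1.trans h2.symm
      rw [Prod.mk.injEq, div_left_inj' hx] at h
      simp only [Finset.mem_coe, Finset.mem_sigma, Finset.mem_product, Finset.mem_filter]
      refine ⟨Finset.sub_mem_sub (hBA a ha).1 (hBA a' ha').1, ⟨⟨ha, ha'⟩, trivial⟩,
        ⟨⟨hb, hb'⟩, ?_⟩, ⟨hc, hc'⟩, ?_⟩ <;> linarith [h.1, h.2]
    · rintro ⟨l, ⟨a, b, c⟩, ⟨a', b', c'⟩⟩ hq ⟨m, ⟨e, f, g⟩, ⟨e', f', g'⟩⟩ hr heq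
      simp only [Finset.mem_coe, Finset.mem_sigma, Finset.mem_product, Finset.mem_filter] at hq hr
      simp only [Sigma.mk.injEq, heq_eq_eq, Prod.mk.injEq] at heq
      obtain ⟨-, ⟨rfl, rfl⟩, ⟨rfl, rfl⟩, rfl, rfl⟩ := heq
      obtain rfl : l = m := hq.2.1.2.symm.trans hr.2.1.2
      rfl
  have hCS := sq_sum_le_card_mul_sum_sq (s := dilatePairs A x)
    (f := fun l => ((T.filter (fun t => φ t = l)).card : ℝ))
  have e : ((B.card : ℝ) ^ 2 * A.card) =
      ∑ l ∈ dilatePairs A x, ((T.filter (fun t => φ t = l)).card : ℝ) := by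
    rw [← Nat.cast_sum, ← hfib, hcardT]; push_cast; ring
  rw [e]
  refine hCS.trans ?_
  gcongr
  exact_mod_cast hsecond

/-- An element a of A ∩ xA is the same as a pair (a, a/x) of ratio x, and every pair in A × A has
exactly one ratio. -/
lemma sum_card_dilatePart {A : Finset ℝ} (hA : (0 : ℝ) ∉ A) :
    ∑ x ∈ quotientSet A A, (dilatePart A x).card = A.card ^ 2 := by
  have hmaps : ∀ p ∈ A ×ˢ A, p.1 / p.2 ∈ quotientSet A A := fun p hp =>
    div_mem_quotientSet hA (Finset.mem_product.1 hp).1 (Finset.mem_product.1 hp).2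
  rw [sq, ← Finset.card_product, Finset.card_eq_sum_card_fiberwise hmaps]
  refine Finset.sum_congr rfl fun x hx => ?_
  have hx0 := ne_zero_of_mem_quotientSet hA hx
  refine Finset.card_bij' (fun a _ => (a, a / x)) (fun p _ => p.1) ?_ ?_ ?_ ?_
  · intro a ha
    obtain ⟨ha, hax⟩ := Finset.mem_filter.1 ha
    have ha0 : a ≠ 0 := fun h => hA (h ▸ ha)
    simp only [Finset.mem_filter, Finset.mem_product]
    exact ⟨⟨ha, hax⟩, by field_simp⟩
  · rintro ⟨a, b⟩ hp
    simp only [Finset.mem_filter, Finset.mem_product] at hp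
    obtain ⟨⟨ha, hb⟩, rfl⟩ := hp
    have ha0 : a ≠ 0 := fun h => hA (h ▸ ha)
    refine Finset.mem_filter.2 ⟨ha, ?_⟩
    rwa [div_div_cancel₀ ha0]
  · intro a _
    rfl
  · rintro ⟨a, b⟩ hp
    simp only [Finset.mem_filter, Finset.mem_product] at hp
    obtain ⟨⟨ha, hb⟩, rfl⟩ := hp
    have ha0 : a ≠ 0 := fun h => hA (h ▸ ha)
    simp only [div_div_cancel₀ ha0]

/-- Many dilations `x` for which `A ∩ x A` has a common, large, dyadic size. -/
lemma exists_dyadic_dilations {A : Finset ℝ} (hA : (0 : ℝ) ∉ A) (hne : A.Nonempty) :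
    ∃ P ⊆ quotientSet A A, ∃ t : ℕ, P.Nonempty ∧
      (∀ x ∈ P, t ≤ (dilatePart A x).card ∧ (dilatePart A x).card ≤ 2 * t) ∧
      A.card ^ 2 ≤ 4 * (quotientSet A A).card * t ∧
      A.card ^ 2 ≤ 4 * (Nat.log 2 A.card + 1) * (P.card * t) := by
  set Q := quotientSet A A
  set r : ℝ → ℕ := fun x => (dilatePart A x).card
  have ha : 0 < A.card := hne.card_pos
  have hq : 0 < Q.card := ha.trans_le (card_le_card_quotientSet hA)
  -- The ratios left out have fewer than |A|²/(2|Q|) representations each, so together they carry at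
  -- most half of the total |A|².
  set G := Q.filter (fun x => A.card ^ 2 ≤ 2 * Q.card * r x)
  have hsum : ∑ x ∈ Q, r x = A.card ^ 2 := sum_card_dilatePart hA
  have hG : A.card ^ 2 ≤ 2 * ∑ x ∈ G, r x := by
    have hsplit := Finset.sum_filter_add_sum_filter_not Q
      (fun x => A.card ^ 2 ≤ 2 * Q.card * r x) r
    have hbad : 2 * Q.card * ∑ x ∈ Q.filter (fun x => ¬ A.card ^ 2 ≤ 2 * Q.card * r x), r x ≤
        Q.card * A.card ^ 2 := by
      rw [Finset.mul_sum]
      calc _ ≤ ∑ x ∈ Q.filter (fun x => ¬ A.card ^ 2 ≤ 2 * Q.card * r x), A.card ^ 2 :=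
            Finset.sum_le_sum fun x hx => (not_le.1 (Finset.mem_filter.1 hx).2).le
        _ ≤ _ := by
            rw [Finset.sum_const, smul_eq_mul]
            exact Nat.mul_le_mul_right _ (Finset.card_filter_le _ _)
    have hbad' : 2 * ∑ x ∈ Q.filter (fun x => ¬ A.card ^ 2 ≤ 2 * Q.card * r x), r x ≤
        A.card ^ 2 := by
      refine Nat.le_of_mul_le_mul_left ?_ hq
      calc _ = _ := by ring
        _ ≤ _ := hbad
    rw [hsum] at hsplit
    change ∑ x ∈ G, r x + _ = _ at hsplit
    omega
  have hrpos : ∀ x ∈ G, r x ≠ 0 := by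
    intro x hx h0
    have h := (Finset.mem_filter.1 hx).2
    rw [h0, mul_zero] at h
    exact absurd h (not_le.2 (by positivity))
  have hmaps : ∀ x ∈ G, Nat.log 2 (r x) ∈ Finset.range (Nat.log 2 A.card + 1) := by
    intro x _
    rw [Finset.mem_range]
    exact Nat.lt_succ_of_le (Nat.log_mono_right (Finset.card_filter_le _ _))
  -- Pigeonhole over the dyadic levels of `r`.
  obtain ⟨j, -, hj⟩ : ∃ j ∈ Finset.range (Nat.log 2 A.card + 1), A.card ^ 2 ≤
      (Nat.log 2 A.card + 1) * (2 * ∑ x ∈ G.filter (fun x => Nat.log 2 (r x) = j), r x) := by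
    by_contra hcon
    push Not at hcon
    have h1 := Finset.sum_lt_sum_of_nonempty ⟨0, by simp⟩ hcon
    rw [Finset.sum_const, Finset.card_range, smul_eq_mul, ← Finset.mul_sum, ← Finset.mul_sum,
      Finset.sum_fiberwise_of_maps_to hmaps] at h1
    exact absurd (Nat.lt_of_mul_lt_mul_left h1) (not_lt.2 hG)
  set P := G.filter (fun x => Nat.log 2 (r x) = j)
  have hr : ∀ x ∈ P, 2 ^ j ≤ r x ∧ r x ≤ 2 * 2 ^ j := by
    intro x hx
    obtain ⟨hxG, hxj⟩ := Finset.mem_filter.1 hx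
    constructor
    · rw [← hxj]
      exact Nat.pow_log_le_self 2 (hrpos x hxG)
    · rw [← hxj, ← pow_succ']
      exact (Nat.lt_pow_succ_log_self (by norm_num) _).le
  have hPne : P.Nonempty := by
    by_contra h
    rw [Finset.not_nonempty_iff_eq_empty] at h
    rw [h, Finset.sum_empty, mul_zero, mul_zero] at hj
    exact absurd hj (not_le.2 (by positivity))
  refine ⟨P, (Finset.filter_subset _ _).trans (Finset.filter_subset _ _), 2 ^ j, hPne, hr, ?_, ?_⟩
  · obtain ⟨x, hx⟩ := hPne
    have h1 := (Finset.mem_filter.1 (Finset.mem_filter.1 hx).1).2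
    calc _ ≤ 2 * Q.card * r x := h1
      _ ≤ 2 * Q.card * (2 * 2 ^ j) := Nat.mul_le_mul_left _ (hr x hx).2
      _ = _ := by ring
  · calc _ ≤ _ := hj
      _ ≤ (Nat.log 2 A.card + 1) * (2 * ∑ x ∈ P, 2 * 2 ^ j) := by
          gcongr with x hx
          exact (hr x hx).2
      _ = _ := by rw [Finset.sum_const, smul_eq_mul]; ring

lemma card_quotientSet_le (A : Finset ℝ) : (quotientSet A A).card ≤ A.card ^ 2 := by
  rw [sq]
  exact (Finset.card_image₂_le _ _ _).trans (Nat.mul_le_mul_left _ (Finset.card_filter_le _ _))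

/-- Pairs with m ≠ 0 are incidences of the grid P × D with lines of non-zero slope; those with m = 0
number at most |P||D|. The lower-order terms are absorbed using 1 ≤ |P| ≤ |Q| ≤ |A|² ≤ |D|², and
2748 = 4(686 + 1). -/
lemma sum_card_dilatePairs_le {A P : Finset ℝ} (hne : A.Nonempty) (hPne : P.Nonempty)
    (hP : P ⊆ quotientSet A A) :
    (∑ x ∈ P, ((dilatePairs A x).card : ℝ)) ^ 3 ≤
      2748 * ((P.card : ℝ) ^ 2 * ((A - A).card : ℝ) ^ 6) := by
  set D := A - A
  set L := (D ×ˢ D).filter (fun l => l.1 ≠ 0)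
  have hAD : A.card ≤ D.card := by
    obtain ⟨b, hb⟩ := hne
    exact Finset.card_le_card_of_injOn (fun a => a - b) (fun a ha => Finset.sub_mem_sub ha hb)
      (fun x _ y _ h => sub_left_injective h)
  have hle : ∑ x ∈ P, (dilatePairs A x).card ≤ (gridIncidences P D L).card + P.card * D.card := by
    have e : ∑ x ∈ P, (dilatePairs A x).card =
        (P.sigma (fun x => dilatePairs A x)).card := (Finset.card_sigma _ _).symm
    rw [e, ← Finset.card_product,
      ← Finset.card_filter_add_card_filter_not (s := P.sigma (fun x => dilatePairs A x))
        (fun q => q.2.1 ≠ 0)]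
    refine Nat.add_le_add ?_ ?_
    · refine Finset.card_le_card_of_injOn (fun q => (q.1, q.2)) ?_ ?_
      · rintro ⟨x, l⟩ hq
        simp only [Finset.mem_coe, Finset.mem_filter, Finset.mem_sigma, dilatePairs] at hq
        simp only [gridIncidences, L, Finset.mem_coe, Finset.mem_filter, Finset.mem_product]
        simp only [Finset.mem_product] at hq
        tauto
      · rintro ⟨x, l⟩ _ ⟨y, m⟩ _ h
        simp only [Prod.mk.injEq] at h
        obtain ⟨rfl, rfl⟩ := h
        rfl
    · refine Finset.card_le_card_of_injOn (fun q => (q.1, q.2.2)) ?_ ?_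
      · rintro ⟨x, l⟩ hq
        simp only [Finset.mem_coe, Finset.mem_filter, Finset.mem_sigma, dilatePairs,
          Finset.mem_product] at hq
        simp only [Finset.mem_coe, Finset.mem_product]
        tauto
      · rintro ⟨x, l⟩ hq ⟨y, m⟩ hr h
        simp only [Finset.mem_coe, Finset.mem_filter, not_not] at hq hr
        simp only [Prod.mk.injEq] at h
        obtain ⟨rfl, h⟩ := h
        obtain rfl : l = m := Prod.ext (hq.2.trans hr.2.symm) h
        rfl
  have hST := card_gridIncidences_cube_le P D L (fun l hl => (Finset.mem_filter.1 hl).2)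
  have hLc : (L.card : ℝ) ≤ (D.card : ℝ) ^ 2 := by
    have : L.card ≤ D.card ^ 2 := by
      rw [sq, ← Finset.card_product]
      exact Finset.card_filter_le _ _
    exact_mod_cast this
  have hPD : (P.card : ℝ) ≤ (D.card : ℝ) ^ 2 := by
    have : P.card ≤ D.card ^ 2 := (Finset.card_le_card hP).trans
      ((card_quotientSet_le A).trans (Nat.pow_le_pow_left hAD 2))
    exact_mod_cast this
  have hle' : ∑ x ∈ P, ((dilatePairs A x).card : ℝ) ≤
      (gridIncidences P D L).card + (P.card : ℝ) * D.card := by exact_mod_cast hle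
  have h0 : 0 ≤ ∑ x ∈ P, ((dilatePairs A x).card : ℝ) := by positivity
  have hp : (1 : ℝ) ≤ P.card := by exact_mod_cast hPne.card_pos
  have hd : (1 : ℝ) ≤ D.card := by exact_mod_cast hne.card_pos.trans_le hAD
  have hl0 : (0 : ℝ) ≤ L.card := by positivity
  have hg0 : (0 : ℝ) ≤ (gridIncidences P D L).card := by positivity
  refine (pow_le_pow_left₀ h0 hle' 3).trans ?_
  generalize ((gridIncidences P D L).card : ℝ) = g at *
  generalize (P.card : ℝ) = p at *
  generalize (D.card : ℝ) = d at *
  generalize (L.card : ℝ) = l at *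
  have h1 : g ^ 3 ≤ 686 * (p ^ 2 * d ^ 6) := by
    calc g ^ 3 ≤ 343 * ((p * d * l) ^ 2 + l ^ 3) := hST
      _ ≤ 343 * ((p * d * d ^ 2) ^ 2 + (d ^ 2) ^ 3) := by gcongr
      _ = 343 * (p ^ 2 * d ^ 6 + 1 * d ^ 6) := by ring
      _ ≤ 343 * (p ^ 2 * d ^ 6 + p ^ 2 * d ^ 6) := by
          gcongr
          exact one_le_pow₀ hp
      _ = _ := by ring
  have h2 : (p * d) ^ 3 ≤ p ^ 2 * d ^ 6 := by
    have : p ≤ d ^ 3 := hPD.trans (pow_le_pow_right₀ hd (by norm_num))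
    calc (p * d) ^ 3 = p ^ 2 * d ^ 3 * p := by ring
      _ ≤ p ^ 2 * d ^ 3 * d ^ 3 := by gcongr
      _ = _ := by ring
  have h3 := add_pow_le hg0 (by positivity : 0 ≤ p * d) 3
  norm_num at h3
  linarith

/-! ### Combining the estimates -/

/-- The difference–quotient inequality for sets without zero. -/
lemma card_pow_le_of_zero_notMem {A : Finset ℝ} (hA : (0 : ℝ) ∉ A) (hne : A.Nonempty) :
    (A.card : ℝ) ^ 23 ≤ 65536 * (2748 * (16 * 5488 ^ 3)) * ((Nat.log 2 A.card + 1 : ℕ) : ℝ) ^ 4 *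
      (((A - A).card : ℝ) ^ 6 * ((quotientSet A A).card : ℝ) ^ 13) := by
  obtain ⟨P, hP, t, hPne, hr, ht, hPt⟩ := exists_dyadic_dilations hA hne
  have hInc := sum_card_dilatePairs_le hne hPne hP
  have hE := sum_diffRep_cube_le hA subset_rfl (A - A)
  have hEx : ∀ x, _ := fun x => sum_diffRep_cube_le hA
    (Finset.filter_subset (fun a => a / x ∈ A) A) (A - A)
  set Q := quotientSet A A
  set ℓ := Nat.log 2 A.card + 1
  have ha : (0 : ℝ) < A.card := by exact_mod_cast hne.card_pos
  have hp : (0 : ℝ) < P.card := by exact_mod_cast hPne.card_pos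
  have ht' : (A.card : ℝ) ^ 2 ≤ 4 * Q.card * t := by exact_mod_cast ht
  have hPt' : (A.card : ℝ) ^ 2 ≤ 4 * ℓ * (P.card * t) := by exact_mod_cast hPt
  have hq0 : (0 : ℝ) ≤ Q.card := by positivity
  have ht0 : (0 : ℝ) < t := by
    rcases Nat.eq_zero_or_pos t with h | h
    · rw [h] at ht'
      simp only [Nat.cast_zero, mul_zero] at ht'
      exact absurd ht' (not_le.2 (by positivity))
    · exact_mod_cast h
  -- The Hölder bound E₃(A_x)² E₃(A) for the cube of the mixed energy, with the third energy bounds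
  -- and |A_x| ≤ 2t inserted. `F` is its cube root.
  set M : ℝ := 16 * 5488 ^ 3 * (ℓ : ℝ) ^ 3 * (Q.card : ℝ) ^ 6 * (t : ℝ) ^ 4 / A.card
  obtain ⟨F, hF0, hF⟩ : ∃ F : ℝ, 0 ≤ F ∧ F ^ 3 = M := by
    refine ⟨M ^ ((1 : ℝ) / 3), by positivity, ?_⟩
    rw [← Real.rpow_natCast, ← Real.rpow_mul (by positivity)]
    norm_num
  have hFx : ∀ x ∈ P,
      ∑ d ∈ A - A, (diffRep (dilatePart A x) d : ℝ) ^ 2 * diffRep A d ≤ F := by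
    intro x hx
    refine le_of_pow_le_pow_left₀ three_ne_zero hF0 ?_
    rw [hF]
    refine (sum_sq_mul_cube_le (A - A) (fun d => (diffRep (dilatePart A x) d : ℝ))
      (fun d => (diffRep A d : ℝ)) (fun _ => by positivity) (fun _ => by positivity)).trans ?_
    have h1 := hEx x
    change (∑ d ∈ A - A, (diffRep (dilatePart A x) d : ℝ) ^ 3) * A.card ≤
      5488 * ℓ * (Q.card : ℝ) ^ 2 * ((dilatePart A x).card : ℝ) ^ 2 at h1
    have h2 : ((dilatePart A x).card : ℝ) ≤ 2 * t := by exact_mod_cast (hr x hx).2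
    have h3 : (∑ d ∈ A - A, (diffRep (dilatePart A x) d : ℝ) ^ 3) * A.card ≤
        5488 * ℓ * (Q.card : ℝ) ^ 2 * (2 * t) ^ 2 := h1.trans (by gcongr)
    have h4 : 0 ≤ ∑ d ∈ A - A, (diffRep (dilatePart A x) d : ℝ) ^ 3 := by positivity
    have h5 : 0 ≤ ∑ d ∈ A - A, (diffRep A d : ℝ) ^ 3 := by positivity
    generalize ∑ d ∈ A - A, (diffRep (dilatePart A x) d : ℝ) ^ 3 = U at *
    generalize ∑ d ∈ A - A, (diffRep A d : ℝ) ^ 3 = V at *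
    rw [le_div_iff₀ ha]
    have h6 : (U * A.card) ^ 2 * (V * A.card) ≤
        (5488 * ℓ * (Q.card : ℝ) ^ 2 * (2 * t) ^ 2) ^ 2 *
          (5488 * ℓ * (Q.card : ℝ) ^ 2 * (A.card : ℝ) ^ 2) := by gcongr
    refine le_of_mul_le_mul_right ?_ (by positivity : (0 : ℝ) < (A.card : ℝ) ^ 2)
    calc _ = (U * A.card) ^ 2 * (V * A.card) := by ring
      _ ≤ _ := h6
      _ = _ := by ring
  have hsum : (P.card : ℝ) * ((t : ℝ) ^ 4 * (A.card : ℝ) ^ 2) ≤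
      (∑ x ∈ P, ((dilatePairs A x).card : ℝ)) * F := by
    rw [Finset.sum_mul, ← nsmul_eq_mul, ← Finset.sum_const]
    refine Finset.sum_le_sum fun x hx => ?_
    have h1 : (t : ℝ) ≤ (dilatePart A x).card := by exact_mod_cast (hr x hx).1
    calc (t : ℝ) ^ 4 * (A.card : ℝ) ^ 2 = ((t : ℝ) ^ 2 * A.card) ^ 2 := by ring
      _ ≤ (((dilatePart A x).card : ℝ) ^ 2 * A.card) ^ 2 := by gcongr
      _ ≤ _ := card_dilatePart_sq_mul_card_sq_le A (ne_zero_of_mem_quotientSet hA (hP hx))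
      _ ≤ _ := by
          gcongr
          exact hFx x hx
  have hcube := pow_le_pow_left₀ (by positivity) hsum 3
  rw [mul_pow _ F, hF] at hcube
  have hcube' := hcube.trans (mul_le_mul_of_nonneg_right hInc (by positivity : 0 ≤ M))
  simp only [M] at hcube'
  generalize ((A - A).card : ℝ) = d at *
  generalize hℓ : (ℓ : ℝ) = l at *
  have hl0 : 0 ≤ l := by rw [← hℓ]; positivity
  generalize (A.card : ℝ) = a at *
  generalize (Q.card : ℝ) = q at *
  generalize (P.card : ℝ) = p at *
  generalize (t : ℝ) = τ at *
  have hkey : p * τ ^ 8 * a ^ 7 ≤ 2748 * (16 * 5488 ^ 3) * l ^ 3 * q ^ 6 * d ^ 6 := by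
    refine le_of_mul_le_mul_right ?_ (by positivity : (0 : ℝ) < p ^ 2 * τ ^ 4 / a)
    calc _ = (p * (τ ^ 4 * a ^ 2)) ^ 3 := by field_simp
      _ ≤ _ := hcube'
      _ = _ := by ring
  -- The lower bound on t is used seven times and the one on |P|t once, matching p τ⁸.
  calc a ^ 23 = (a ^ 2) ^ 7 * (a ^ 2) * a ^ 7 := by ring
    _ ≤ (4 * q * τ) ^ 7 * (4 * l * (p * τ)) * a ^ 7 := by gcongr
    _ = 65536 * q ^ 7 * l * (p * τ ^ 8 * a ^ 7) := by ring
    _ ≤ 65536 * q ^ 7 * l * (2748 * (16 * 5488 ^ 3) * l ^ 3 * q ^ 6 * d ^ 6) := by gcongr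
    _ = _ := by ring

/-- Deleting 0 at most halves `A`, whence 2^23, and only shrinks the difference and quotient sets.
As |A| ≥ 2, the factor ⌊log⌋ + 1 is at most 2 log|A|, whence 16 = 2⁴. -/
lemma exists_card_pow_le : ∃ C : ℝ, 0 < C ∧ ∀ A : Finset ℝ, 2 ≤ A.card →
    (A.card : ℝ) ^ 23 ≤ C * (Real.logb 2 (A.card : ℝ)) ^ (4 : ℝ) *
      (((A - A).card : ℝ) ^ 6 * ((quotientSet A A).card : ℝ) ^ 13) := by
  refine ⟨2 ^ 23 * (65536 * (2748 * (16 * 5488 ^ 3)) * 16), by positivity, fun A hA2 => ?_⟩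
  set B := A.erase 0
  have hBA : B ⊆ A := Finset.erase_subset _ _
  have hcard : A.card - 1 ≤ B.card := Finset.pred_card_le_card_erase
  have hBne : B.Nonempty := Finset.card_pos.1 (by omega)
  have h1 := card_pow_le_of_zero_notMem (A := B) (Finset.notMem_erase 0 A) hBne
  have hlog : ((Nat.log 2 B.card + 1 : ℕ) : ℝ) ≤ 2 * Real.logb 2 (A.card : ℝ) := by
    have h2 : (Nat.log 2 B.card : ℝ) ≤ Real.logb 2 (A.card : ℝ) := by
      have h3 : Nat.log 2 B.card ≤ Nat.log 2 A.card :=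
        Nat.log_mono_right (Finset.card_le_card hBA)
      exact (Nat.cast_le.2 h3).trans (by exact_mod_cast Real.natLog_le_logb A.card 2)
    have h4 : (1 : ℝ) ≤ Real.logb 2 (A.card : ℝ) := by
      rw [Real.le_logb_iff_rpow_le (by norm_num) (by positivity), Real.rpow_one]
      exact_mod_cast hA2
    push_cast
    linarith
  have hD : ((B - B).card : ℝ) ≤ (A - A).card := by
    exact_mod_cast Finset.card_le_card (Finset.sub_subset_sub hBA hBA)
  have hQ : ((quotientSet B B).card : ℝ) ≤ (quotientSet A A).card := by
    exact_mod_cast Finset.card_le_card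
      (Finset.image₂_subset hBA (Finset.filter_subset_filter _ hBA))
  have hAB : (A.card : ℝ) ≤ 2 * B.card := by
    have : A.card ≤ 2 * B.card := by omega
    exact_mod_cast this
  calc (A.card : ℝ) ^ 23 ≤ (2 * B.card) ^ 23 := by gcongr
    _ = 2 ^ 23 * (B.card : ℝ) ^ 23 := by ring
    _ ≤ 2 ^ 23 * (65536 * (2748 * (16 * 5488 ^ 3)) * (2 * Real.logb 2 (A.card : ℝ)) ^ 4 *
        (((A - A).card : ℝ) ^ 6 * ((quotientSet A A).card : ℝ) ^ 13)) := by
        refine mul_le_mul_of_nonneg_left (h1.trans ?_) (by positivity)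
        gcongr
    _ = _ := by
        rw [show (4 : ℝ) = ((4 : ℕ) : ℝ) by norm_num, Real.rpow_natCast]
        ring

theorem theorem4 :
    (∃ C : ℝ, 0 < C ∧ ∃ c : ℝ, 0 < c ∧ ∀ A : Finset ℝ, 2 ≤ A.card →
      (A.card : ℝ) ^ 23 ≤
        C * (Real.logb 2 (A.card : ℝ)) ^ c *
          (((A - A).card : ℝ) ^ 6 * ((quotientSet A A).card : ℝ) ^ 13)) ∧
    (∃ c : ℝ, 0 < c ∧ ∀ K : ℝ, 0 < K → ∃ C : ℝ, 0 < C ∧ ∀ A : Finset ℝ, 2 ≤ A.card →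
      ((quotientSet A A).card : ℝ) ≤ K * (A.card : ℝ) →
      (A.card : ℝ) ^ (5 / 3 : ℝ) ≤
        C * (Real.logb 2 (A.card : ℝ)) ^ c * ((A - A).card : ℝ)) := by
  obtain ⟨C, hC, h⟩ := exists_card_pow_le
  -- The second part is the sixth root of the first after inserting |A/A| ≤ K|A| and cancelling
  -- |A|¹³: this gives the exponents 10/6 = 5/3 and 4/6.
  refine ⟨⟨C, hC, 4, by norm_num, h⟩, 4 / 6, by norm_num, fun K hK => ?_⟩
  refine ⟨(C * K ^ 13) ^ ((1 : ℝ) / 6), by positivity, fun A hA2 hAK => ?_⟩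
  have ha : (0 : ℝ) < A.card := by
    have : 0 < A.card := by omega
    exact_mod_cast this
  have hlog : 0 ≤ Real.logb 2 (A.card : ℝ) :=
    Real.logb_nonneg (by norm_num) (by exact_mod_cast (by omega : 1 ≤ A.card))
  have h1 := h A hA2
  have hd : (0 : ℝ) ≤ (A - A).card := by positivity
  have hq : (0 : ℝ) ≤ (quotientSet A A).card := by positivity
  generalize ((A - A).card : ℝ) = d at *
  generalize ((quotientSet A A).card : ℝ) = q at *
  generalize Real.logb 2 (A.card : ℝ) = l at *
  generalize (A.card : ℝ) = a at *
  have h2 : a ^ 10 ≤ C * K ^ 13 * l ^ (4 : ℝ) * d ^ 6 := by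
    refine le_of_mul_le_mul_right ?_ (by positivity : (0 : ℝ) < a ^ 13)
    calc a ^ 10 * a ^ 13 = a ^ 23 := by ring
      _ ≤ _ := h1
      _ ≤ C * l ^ (4 : ℝ) * (d ^ 6 * (K * a) ^ 13) := by gcongr
      _ = _ := by ring
  refine le_of_pow_le_pow_left₀ (n := 6) (by norm_num) (by positivity) ?_
  have e1 : (a ^ (5 / 3 : ℝ)) ^ 6 = a ^ 10 := by
    rw [← Real.rpow_natCast, ← Real.rpow_mul ha.le, ← Real.rpow_natCast]
    norm_num
  have e2 : ((C * K ^ 13) ^ ((1 : ℝ) / 6)) ^ 6 = C * K ^ 13 := by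
    rw [← Real.rpow_natCast, ← Real.rpow_mul (by positivity)]
    norm_num
  have e3 : (l ^ (4 / 6 : ℝ)) ^ 6 = l ^ (4 : ℝ) := by
    rw [← Real.rpow_natCast, ← Real.rpow_mul hlog]
    norm_num
  rw [e1, mul_pow, mul_pow, e2, e3]
  exact h2
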